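/- There is an absolute constant $C>0$ such that the following holds. Let $D$ be a set, let $B(D)$ be the space of all bounded complex-valued functions on $D$ with the sup-norm $\|f\|_\infty=\sup_{x\in D}|f(x)|$, and let $V_n$ be an $n$-dimensional linear subspace of $B(D)$. Then there are $2n$ points $x_1,\dots,x_{2n}\in D$ (not necessarily distinct) and functions $\varphi_1,\dots,\varphi_{2n}\in V_n$ such that $$P\colon B(D)\to V_n,\qquad Pf=\sum_{i=1}^{2n} f(x_i)\,\varphi_i,$$ is a projection onto $V_n$, i.e. $Pg=g$ for all $g\in V_n$, with operator norm $\|P\|\le C\sqrt n$. Moreover, the points can be chosen so that, with $\|f\|_X:=\big(\frac1{2n}\sum_{i=1}^{2n}|f(x_i)|^2\big)^{1/2}$ (and $\|f\|_X:=0$ if $n=0$), they discretize the sup-norm on $V_n$ in the sense that $\|g\|_\infty\le C\sqrt n\,\|g\|_X$ for all $g\in V_n$, and $P$ is the unweighted least-squares algorithm on them: for every $f\in B(D)$, $Pf$ is the unique minimizer of $\|g-f\|_X$ over $g\in V_n$. -/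

import Mathlib

/-- The Banach space `B(D)` of all bounded complex-valued functions on a set `D`,
with the sup-norm `‖f‖ = sup_{x ∈ D} |f x|`. -/
abbrev BoundedFun (D : Type*) : Type _ := lp (fun _ : D => ℂ) ⊤

/-- The seminorm `‖f‖_X = ((1 / |X|) ∑_{x ∈ X} |f x| ^ 2) ^ (1 / 2)` of a finite multiset
`X = {x 1, …, x m}` of points of `D`, given as a family (repetitions are allowed). -/
noncomputable def sampleNorm {D : Type*} {m : ℕ} (x : Fin m → D) (f : BoundedFun D) : ℝ :=
  Real.sqrt ((1 / (m : ℝ)) * ∑ i, ‖f (x i)‖ ^ 2)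

/-- `A` is the unweighted least-squares algorithm on the sample points `x` with values in `V`:
for every `f`, `A f` is the unique minimizer over `g ∈ V` of `‖g - f‖_X`. -/
def IsLeastSquares {D : Type*} {m : ℕ} (x : Fin m → D) (V : Submodule ℂ (BoundedFun D))
    (A : BoundedFun D → V) : Prop :=
  ∀ (f : BoundedFun D) (g : V), g ≠ A f →
    sampleNorm x ((A f : BoundedFun D) - f) < sampleNorm x ((g : BoundedFun D) - f)

/-! Fix a basis of V, let v(d) be the vector of its values at d, and let A have rows v(x_i). Choose
the 2n points so that det(AᴴA) is within a factor 2 of its supremum. The 2n row leverages sum to n,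
so some row has leverage at most 1/2. Exchanging it for v(d) multiplies the determinant by at least
(1 + ℓ(d))/2, where ℓ(d) is the leverage of v(d); near-optimality then forces ℓ(d) ≤ 3 for every d.

By Cauchy–Schwarz |g(d)|² ≤ ℓ(d) ∑ |g(x_i)|², whence ‖g‖_∞ ≤ 2√(2n) ‖g‖_X ≤ 3√n ‖g‖_X on V. Least
squares is an orthogonal projection in ℓ², hence contractive for ‖·‖_X, and ‖f‖_X ≤ ‖f‖_∞, so the
same constant bounds ‖P‖. -/

open Matrix in
/-- The sesquilinear form `v ↦ w ↦ vᵀ (Aᴴ A)⁻¹ w̄` attached to a design matrix `A`. -/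
noncomputable def leverage {m n : Type*} [Fintype m] [Fintype n] [DecidableEq n]
    (A : Matrix m n ℂ) (v w : n → ℂ) : ℂ :=
  v ⬝ᵥ ((Aᴴ * A)⁻¹ *ᵥ star w)

/-! ### Leverages and row exchange in a Gram determinant -/

section DesignMatrix

open Matrix ComplexOrder

variable {m n : Type*} [Fintype m] [Fintype n] [DecidableEq n]

theorem leverage_conj (A : Matrix m n ℂ) (v w : n → ℂ) :
    star (leverage A v w) = leverage A w v := by
  have h : ((Aᴴ * A)⁻¹)ᴴ = (Aᴴ * A)⁻¹ := (isHermitian_conjTranspose_mul_self A).inv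
  rw [leverage, leverage, ← star_dotProduct_star, star_mulVec, star_star, h,
    ← dotProduct_mulVec]

theorem leverage_self_nonneg (A : Matrix m n ℂ) (v : n → ℂ) : 0 ≤ leverage A v v := by
  have h : ((Aᴴ * A)⁻¹).PosSemidef := (posSemidef_conjTranspose_mul_self A).inv
  simpa [leverage] using h.dotProduct_mulVec_nonneg (star v)

/-- The leverages are the diagonal of A(AᴴA)⁻¹Aᴴ, whose trace is computed cyclically. -/
theorem sum_leverage_row (A : Matrix m n ℂ) (hA : IsUnit (Aᴴ * A).det) :
    ∑ i, leverage A (A i) (A i) = Fintype.card n := by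
  have h : ∑ i, leverage A (A i) (A i) = (A * ((Aᴴ * A)⁻¹ * Aᴴ)).trace := by
    simp only [trace, diag_apply, leverage]
    refine Finset.sum_congr rfl fun i _ => ?_
    rw [mul_apply']
    rfl
  rw [h, trace_mul_comm, Matrix.mul_assoc, nonsing_inv_mul _ hA, trace_one]

omit [Fintype n] [DecidableEq n] in
theorem conjTranspose_mul_self_updateRow [DecidableEq m] (A : Matrix m n ℂ) (i : m) (w : n → ℂ) :
    (A.updateRow i w)ᴴ * A.updateRow i w =
      Aᴴ * A + (of ![star w, -star (A i)])ᵀ * of ![w, A i] := by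
  ext j k
  simp only [mul_apply, conjTranspose_apply, Matrix.add_apply, Fin.sum_univ_two, transpose_apply, of_apply,
    cons_val_zero, cons_val_one, Pi.star_apply, Pi.neg_apply]
  rw [← Finset.add_sum_erase _ _ (Finset.mem_univ i),
    ← Finset.add_sum_erase _ (fun l => star (A l j) * A l k) (Finset.mem_univ i),
    Finset.sum_congr rfl (g := fun l => star (A l j) * A l k)]
  · simp only [updateRow_self]
    ring
  · intro l hl
    rw [updateRow_ne (Finset.ne_of_mem_erase hl)]

/-- The exchange is a rank-two update of AᴴA, so the matrix determinant lemma leaves a 2 × 2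
determinant. -/
theorem det_conjTranspose_mul_self_updateRow [DecidableEq m] (A : Matrix m n ℂ)
    (hA : IsUnit (Aᴴ * A).det) (i : m) (w : n → ℂ) :
    ((A.updateRow i w)ᴴ * A.updateRow i w).det =
      (Aᴴ * A).det * ((1 + leverage A w w) * (1 - leverage A (A i) (A i)) +
        leverage A w (A i) * leverage A (A i) w) := by
  have h : ∀ a b : Fin 2, (of ![w, A i] * (Aᴴ * A)⁻¹ * (of ![star w, -star (A i)])ᵀ) a b =
      (![w, A i] a) ⬝ᵥ ((Aᴴ * A)⁻¹ *ᵥ (![star w, -star (A i)] b)) := by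
    intro a b
    rw [Matrix.mul_assoc, mul_apply']
    rfl
  rw [conjTranspose_mul_self_updateRow, det_add_mul _ _ hA, det_fin_two]
  simp only [Matrix.add_apply, h, one_apply_eq, cons_val_zero, cons_val_one, mulVec_neg, dotProduct_neg,
    leverage, ne_eq, zero_ne_one, one_ne_zero, not_false_eq_true, one_apply_ne]
  ring

/-- Exchanging a row for another one does not increase the Gram determinant by more than
the factor given by the leverages of the two rows. -/
theorem norm_det_updateRow_ge [DecidableEq m] (A : Matrix m n ℂ)
    (hA : IsUnit (Aᴴ * A).det) (i : m) (w : n → ℂ) :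
    ‖(Aᴴ * A).det‖ * ((1 + (leverage A w w).re) * (1 - (leverage A (A i) (A i)).re)) ≤
      ‖((A.updateRow i w)ᴴ * A.updateRow i w).det‖ := by
  rw [det_conjTranspose_mul_self_updateRow A hA, norm_mul]
  refine mul_le_mul_of_nonneg_left ?_ (norm_nonneg _)
  refine le_trans ?_ (Complex.re_le_norm _)
  have h1 := (Complex.nonneg_iff.1 (leverage_self_nonneg A w)).2
  -- The cross leverages are conjugate, so their product is nonnegative and can be dropped.
  have h2 : leverage A w (A i) * leverage A (A i) w = (‖leverage A w (A i)‖ ^ 2 : ℝ) := by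
    rw [← leverage_conj A w (A i)]
    simpa using Complex.mul_conj' (leverage A w (A i))
  rw [h2]
  simp only [Complex.add_re, Complex.mul_re, Complex.add_im, Complex.one_im, Complex.one_re,
    Complex.sub_re, Complex.sub_im, Complex.ofReal_re, ← h1]
  nlinarith [sq_nonneg ‖leverage A w (A i)‖]

theorem exists_leverage_row_le (A : Matrix m n ℂ) (hA : IsUnit (Aᴴ * A).det) [Nonempty m]
    (hcard : 2 * Fintype.card n ≤ Fintype.card m) :
    ∃ i, (leverage A (A i) (A i)).re ≤ 1 / 2 := by
  by_contra! h
  have h1 := Finset.sum_lt_sum_of_nonempty Finset.univ_nonempty fun i _ => h i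
  have h2 := congrArg Complex.re (sum_leverage_row A hA)
  rw [Complex.re_sum, Complex.natCast_re] at h2
  rw [h2, Finset.sum_const, Finset.card_univ, nsmul_eq_mul] at h1
  have h3 : (2 : ℝ) * Fintype.card n ≤ Fintype.card m := by exact_mod_cast hcard
  linarith

/-- With y = (AᴴA)⁻¹w̄, the number w ⬝ᵥ c is the inner product of Ay and Ac, and ‖Ay‖² is the
leverage of w; Cauchy–Schwarz applies. -/
theorem norm_dotProduct_sq_le_leverage (A : Matrix m n ℂ) (hA : IsUnit (Aᴴ * A).det)
    (w c : n → ℂ) :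
    ‖w ⬝ᵥ c‖ ^ 2 ≤ (leverage A w w).re * ∑ i, ‖A i ⬝ᵥ c‖ ^ 2 := by
  set y : n → ℂ := (Aᴴ * A)⁻¹ *ᵥ star w with hy
  have hMy : (Aᴴ * A) *ᵥ y = star w := by
    rw [hy, mulVec_mulVec, mul_nonsing_inv _ hA, one_mulVec]
  have key : ∀ c : n → ℂ, w ⬝ᵥ c = ∑ i, star ((A *ᵥ y) i) * (A *ᵥ c) i := by
    intro c
    have : w = star ((Aᴴ * A) *ᵥ y) := by rw [hMy, star_star]
    conv_lhs => rw [this, ← mulVec_mulVec, star_mulVec, conjTranspose_conjTranspose,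
      ← dotProduct_mulVec]
    rfl
  have hlev : (leverage A w w).re = ∑ i, ‖(A *ᵥ y) i‖ ^ 2 := by
    rw [leverage, ← hy, key, Complex.re_sum]
    refine Finset.sum_congr rfl fun i _ => ?_
    rw [← Complex.normSq_eq_norm_sq, Complex.star_def, ← Complex.normSq_eq_conj_mul_self,
      Complex.ofReal_re]
  rw [hlev, key]
  calc ‖∑ i, star ((A *ᵥ y) i) * (A *ᵥ c) i‖ ^ 2
      ≤ (∑ i, ‖(A *ᵥ y) i‖ * ‖(A *ᵥ c) i‖) ^ 2 := by
        gcongr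
        refine (norm_sum_le _ _).trans_eq ?_
        simp
    _ ≤ _ := Finset.sum_mul_sq_le_sq_mul_sq _ _ _

end DesignMatrix

/-! ### Near-maximizers of the Gram determinant -/

section NearOptimalDesign

open Matrix ComplexOrder

theorem exists_injective_design {D : Type*} {n m : ℕ} (hnm : n ≤ m) (hn : 0 < n)
    (v : D → Fin n → ℂ) (hv : ∀ c, (∀ d, v d ⬝ᵥ c = 0) → c = 0) :
    ∃ x : Fin m → D, Function.Injective (of fun i => v (x i)).mulVec := by
  have hspan : Submodule.span ℂ (Set.range v) = ⊤ := by
    by_contra hne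
    obtain ⟨f, hf0, hf⟩ := Submodule.exists_le_ker_of_lt_top _ (lt_top_iff_ne_top.2 hne)
    have hfc : ∀ u, f u = u ⬝ᵥ fun j => f (Pi.single j 1) := by
      intro u
      conv_lhs => rw [pi_eq_sum_univ' u]
      simp [dotProduct, map_sum]
    have := hv _ fun d => by
      rw [← hfc]
      exact hf (Submodule.subset_span ⟨d, rfl⟩)
    refine hf0 (LinearMap.ext fun u => ?_)
    rw [hfc, this, dotProduct_zero, LinearMap.zero_apply]
  obtain ⟨f, hf, hfs, -⟩ := Submodule.exists_fun_fin_finrank_span_eq ℂ (Set.range v)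
  have hr : Module.finrank ℂ (Submodule.span ℂ (Set.range v)) = n := by
    rw [hspan, finrank_top, Module.finrank_fin_fun]
  choose y hy using hf
  replace hfs := hfs.trans hspan
  -- The n points giving a basis are repeated cyclically to fill m places.
  let σ : Fin m → Fin (Module.finrank ℂ (Submodule.span ℂ (Set.range v))) :=
    fun i => ⟨i % n, by rw [hr]; exact Nat.mod_lt _ hn⟩
  refine ⟨fun i => y (σ i), ?_⟩
  refine (injective_iff_map_eq_zero (mulVecLin (of fun i => v (y (σ i))))).2 fun c hc => ?_
  have hz : ∀ k, f k ⬝ᵥ c = 0 := by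
    intro k
    have hk : (k : ℕ) < n := k.2.trans_eq hr
    have h1 := congrFun hc ⟨k, hk.trans_le hnm⟩
    have h2 : σ ⟨k, hk.trans_le hnm⟩ = k := Fin.ext (Nat.mod_eq_of_lt hk)
    rw [← hy, ← h2]
    exact h1
  refine hv c fun d => ?_
  have hd : v d ∈ Submodule.span ℂ (Set.range f) := hfs ▸ Submodule.mem_top
  generalize v d = w at hd
  induction hd using Submodule.span_induction with
  | mem u hu => obtain ⟨k, rfl⟩ := hu; exact hz k
  | zero => exact zero_dotProduct _
  | add u u' _ _ h h' => rw [add_dotProduct, h, h', add_zero]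
  | smul a u _ h => rw [smul_dotProduct, h, smul_zero]

theorem exists_norm_det_gram_le {D : Type*} {n m : ℕ} (v : D → Fin n → ℂ) (K : ℝ)
    (hK : ∀ d j, ‖v d j‖ ≤ K) :
    ∃ B : ℝ, ∀ x : Fin m → D,
      ‖((of fun i => v (x i))ᴴ * (of fun i => v (x i))).det‖ ≤ B := by
  refine ⟨_, fun x => det_le (abv := NormedField.toAbsoluteValue ℂ) (x := m * (K * K))
    fun j k => ?_⟩
  change ‖((of fun i => v (x i))ᴴ * (of fun i => v (x i))) j k‖ ≤ _
  rw [mul_apply]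
  refine (norm_sum_le _ _).trans ((Finset.sum_le_card_nsmul _ _ (K * K) fun i _ => ?_).trans_eq ?_)
  · rw [norm_mul, conjTranspose_apply, norm_star]
    exact mul_le_mul (hK _ _) (hK _ _) (norm_nonneg _) ((norm_nonneg _).trans (hK (x i) j))
  · simp

/-- A near-optimal design for the determinant criterion with twice as many points as
parameters controls the evaluation functionals by an absolute constant. -/
theorem exists_design_norm_dotProduct_sq_le {D : Type*} {n : ℕ} (hn : 0 < n) (v : D → Fin n → ℂ)
    (hv : ∀ c, (∀ d, v d ⬝ᵥ c = 0) → c = 0) (K : ℝ) (hK : ∀ d j, ‖v d j‖ ≤ K) :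
    ∃ x : Fin (2 * n) → D, ∀ d c, ‖v d ⬝ᵥ c‖ ^ 2 ≤ 4 * ∑ i, ‖v (x i) ⬝ᵥ c‖ ^ 2 := by
  obtain ⟨x₀, hx₀⟩ := exists_injective_design (m := 2 * n) (by omega) hn v hv
  obtain ⟨B, hB⟩ := exists_norm_det_gram_le (m := 2 * n) v K hK
  let F : (Fin (2 * n) → D) → ℝ := fun x =>
    ‖((of fun i => v (x i))ᴴ * (of fun i => v (x i))).det‖
  have hbdd : BddAbove (Set.range F) := ⟨B, by rintro _ ⟨x, rfl⟩; exact hB x⟩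
  have hpos : 0 < ⨆ x, F x :=
    (norm_pos_iff.2 (PosDef.conjTranspose_mul_self _ hx₀).det_pos.ne').trans_le (le_ciSup hbdd x₀)
  have : Nonempty (Fin (2 * n) → D) := ⟨x₀⟩
  -- The supremum need not be attained, since `D` carries no topology; half of it suffices.
  obtain ⟨x, hx⟩ := exists_lt_of_lt_ciSup (half_lt_self hpos)
  have hmax : ∀ y, F y ≤ 2 * F x := fun y => by linarith [le_ciSup hbdd y]
  have hFx : 0 < F x := (half_pos hpos).trans hx
  set A : Matrix (Fin (2 * n)) (Fin n) ℂ := of fun i => v (x i) with hAdef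
  have hA : IsUnit (Aᴴ * A).det := isUnit_iff_ne_zero.2 (norm_pos_iff.1 hFx)
  have : Nonempty (Fin (2 * n)) := ⟨⟨0, by omega⟩⟩
  obtain ⟨i, hi⟩ := exists_leverage_row_le A hA (by simp)
  refine ⟨x, fun d c => (norm_dotProduct_sq_le_leverage A hA (v d) c).trans ?_⟩
  refine mul_le_mul_of_nonneg_right ?_ (Finset.sum_nonneg fun _ _ => sq_nonneg _)
  have h1 := norm_det_updateRow_ge A hA i (v d)
  have h2 : A.updateRow i (v d) = of fun k => v (Function.update x i d k) := by
    ext k j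
    rcases eq_or_ne k i with rfl | hk
    · simp
    · simp [hk, hAdef]
  rw [h2] at h1
  have h3 := h1.trans (hmax (Function.update x i d))
  have h4 := le_of_mul_le_mul_left (h3.trans_eq (mul_comm 2 (F x))) hFx
  have h5 := (Complex.nonneg_iff.1 (leverage_self_nonneg A (v d))).1
  -- From (1 + ℓ)(1 - ℓ_i) ≤ 2 and ℓ_i ≤ 1/2 follows ℓ ≤ 3, which is more than needed.
  nlinarith

end NearOptimalDesign

/-! ### Sampling and least squares -/

/-- The values of a bounded function at finitely many points, as a Euclidean vector. -/
noncomputable def sampling {D : Type*} {m : ℕ} (x : Fin m → D) :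
    BoundedFun D →ₗ[ℂ] EuclideanSpace ℂ (Fin m) where
  toFun f := WithLp.toLp 2 fun i => f (x i)
  map_add' _ _ := rfl
  map_smul' _ _ := rfl

theorem sampleNorm_eq {D : Type*} {m : ℕ} (x : Fin m → D) (f : BoundedFun D) :
    sampleNorm x f = Real.sqrt (1 / (m : ℝ)) * ‖sampling x f‖ := by
  rw [sampleNorm, Real.sqrt_mul (by positivity), EuclideanSpace.norm_eq]
  rfl

theorem sampleNorm_le_norm {D : Type*} {m : ℕ} (x : Fin m → D) (f : BoundedFun D) :
    sampleNorm x f ≤ ‖f‖ := by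
  refine Real.sqrt_le_iff.2 ⟨norm_nonneg _, ?_⟩
  rcases Nat.eq_zero_or_pos m with rfl | hm
  · simp
  have h : ∑ i, ‖f (x i)‖ ^ 2 ≤ m * ‖f‖ ^ 2 := by
    refine (Finset.sum_le_card_nsmul _ _ (‖f‖ ^ 2) fun i _ => ?_).trans_eq (by simp)
    gcongr
    exact lp.norm_apply_le_norm ENNReal.top_ne_zero f _
  have hm' : (0 : ℝ) < m := by exact_mod_cast hm
  rw [one_div, inv_mul_le_iff₀ hm']
  exact h

/-- A finite-dimensional space on which evaluations are bounded and separating is controlled,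
at every point, by the evaluations at twice as many points as its dimension. -/
theorem exists_points_norm_sq_le {D W : Type*} [NormedAddCommGroup W] [NormedSpace ℂ W]
    [FiniteDimensional ℂ W] {n : ℕ} (hn : Module.finrank ℂ W = n) (ev : D → W →ₗ[ℂ] ℂ)
    (hev : ∀ d g, ‖ev d g‖ ≤ ‖g‖) (hsep : ∀ g, (∀ d, ev d g = 0) → g = 0) :
    ∃ x : Fin (2 * n) → D, ∀ d g, ‖ev d g‖ ^ 2 ≤ 4 * ∑ i, ‖ev (x i) g‖ ^ 2 := by
  rcases Nat.eq_zero_or_pos n with rfl | hpos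
  · refine ⟨fun i => Fin.elim0 (Fin.cast (mul_zero 2) i), fun d g => ?_⟩
    have := Module.finrank_zero_iff.1 hn
    rw [Subsingleton.elim g 0]
    simp
  let b := Module.finBasisOfFinrankEq ℂ W hn
  let v : D → Fin n → ℂ := fun d j => ev d (b j)
  have hrepr : ∀ (g : W) (d : D), ev d g = v d ⬝ᵥ ⇑(b.repr g) := by
    intro g d
    conv_lhs => rw [← b.sum_repr g]
    simp only [map_sum, map_smul, smul_eq_mul]
    exact Finset.sum_congr rfl fun _ _ => mul_comm _ _
  have hv : ∀ c, (∀ d, v d ⬝ᵥ c = 0) → c = 0 := by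
    intro c hc
    have h0 : b.equivFun.symm c = 0 := by
      refine hsep _ fun d => ?_
      rw [hrepr, ← b.equivFun_apply, LinearEquiv.apply_symm_apply]
      exact hc d
    exact (LinearEquiv.map_eq_zero_iff _).1 h0
  obtain ⟨x, hx⟩ := exists_design_norm_dotProduct_sq_le hpos v hv (∑ j, ‖b j‖) fun d j =>
    (hev d (b j)).trans
      (Finset.single_le_sum (f := fun j => ‖b j‖) (fun _ _ => norm_nonneg _) (Finset.mem_univ j))
  refine ⟨x, fun d g => ?_⟩
  simp only [hrepr]
  exact hx d _

theorem exists_sampling_points {D : Type*} (V : Submodule ℂ (BoundedFun D)) [FiniteDimensional ℂ V]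
    {n : ℕ} (hn : Module.finrank ℂ V = n) :
    ∃ x : Fin (2 * n) → D, ∀ g : V, ‖g‖ ≤ 2 * ‖sampling x (g : BoundedFun D)‖ := by
  let ev : D → V →ₗ[ℂ] ℂ := fun d =>
    { toFun := fun g => (g : BoundedFun D) d
      map_add' := fun _ _ => rfl
      map_smul' := fun _ _ => rfl }
  obtain ⟨x, hx⟩ := exists_points_norm_sq_le hn ev
    (fun d g => lp.norm_apply_le_norm ENNReal.top_ne_zero (g : BoundedFun D) d)
    (fun g hg => Subtype.ext (lp.ext (funext hg)))
  refine ⟨x, fun g => lp.norm_le_of_forall_le (by positivity) fun d => ?_⟩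
  refine le_of_sq_le_sq ?_ (by positivity)
  rw [mul_pow, EuclideanSpace.norm_sq_eq]
  refine (hx d g).trans_eq ?_
  norm_num
  rfl

/-- Least squares: if `T` is injective on the finite-dimensional subspace `V`, then the best
approximation of a vector from `T V` defines a linear map to `V`. -/
theorem exists_linear_leastSquares {B H : Type*} [AddCommGroup B] [Module ℂ B]
    [NormedAddCommGroup H] [InnerProductSpace ℂ H] (V : Submodule ℂ B) [FiniteDimensional ℂ V]
    (T : B →ₗ[ℂ] H) (hT : ∀ g : V, T g = 0 → g = 0) :
    ∃ Q : H →ₗ[ℂ] V, (∀ g : V, Q (T g) = g) ∧ (∀ u, ‖T (Q u)‖ ≤ ‖u‖) ∧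
      ∀ u (g : V), g ≠ Q u → ‖T (Q u) - u‖ < ‖T g - u‖ := by
  let S : V →ₗ[ℂ] H := T.domRestrict V
  have hS : Function.Injective S := (injective_iff_map_eq_zero _).2 hT
  let e := LinearEquiv.ofInjective S hS
  let R : Submodule ℂ H := LinearMap.range S
  let Q : H →ₗ[ℂ] V := e.symm.toLinearMap ∘ₗ R.orthogonalProjectionOnto.toLinearMap
  have hQ : ∀ u, T (Q u) = R.starProjection u := fun u =>
    congrArg Subtype.val (e.apply_symm_apply (R.orthogonalProjectionOnto u))
  have hmem : ∀ g : V, T g ∈ R := fun g => ⟨g, rfl⟩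
  refine ⟨Q, fun g => hS ?_, fun u => ?_, fun u g hg => ?_⟩
  · exact (hQ _).trans (Submodule.starProjection_eq_self_iff.2 (hmem g))
  · rw [hQ]
    exact Submodule.norm_starProjection_apply_le _ _
  · have hne : T g - T (Q u) ≠ 0 := fun h => hg (hS (sub_eq_zero.1 h))
    have horth : inner ℂ (T g - T (Q u)) (T (Q u) - u) = 0 := by
      have hsub : u - R.starProjection u ∈ Rᗮ := Submodule.sub_starProjection_mem_orthogonal _
      rw [← neg_sub u, inner_neg_right, neg_eq_zero, hQ u]
      refine Submodule.inner_right_of_mem_orthogonal (R.sub_mem (hmem g) ?_) hsub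
      exact Submodule.starProjection_apply_mem _ _
    have hpyth := norm_add_sq_eq_norm_sq_add_norm_sq_of_inner_eq_zero _ _ horth
    rw [sub_add_sub_cancel] at hpyth
    have := norm_pos_iff.2 hne
    refine lt_of_pow_lt_pow_left₀ 2 (norm_nonneg _) ?_
    nlinarith

/-- The least-squares operator for points on which the sampling map is injective on `V`. -/
theorem exists_isLeastSquares {D : Type*} {m : ℕ} (V : Submodule ℂ (BoundedFun D))
    [FiniteDimensional ℂ V] (x : Fin m → D)
    (hx : ∀ g : V, sampling x (g : BoundedFun D) = 0 → g = 0) :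
    ∃ P : BoundedFun D →ₗ[ℂ] V,
      (∃ φ : Fin m → V, ∀ f, P f = ∑ i, f (x i) • φ i) ∧
      (∀ g : V, P (g : BoundedFun D) = g) ∧
      (∀ f, ‖sampling x (P f : BoundedFun D)‖ ≤ ‖sampling x f‖) ∧
      IsLeastSquares x V P := by
  obtain ⟨Q, hQproj, hQle, hQmin⟩ := exists_linear_leastSquares V (sampling x) hx
  refine ⟨Q ∘ₗ sampling x, ⟨fun i => Q (EuclideanSpace.single i 1), fun f => ?_⟩, hQproj,
    fun f => hQle _, fun f g hg => ?_⟩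
  · rw [LinearMap.comp_apply]
    conv_lhs => rw [← (EuclideanSpace.basisFun (Fin m) ℂ).sum_repr (sampling x f)]
    simp only [map_sum, map_smul, EuclideanSpace.basisFun_repr, EuclideanSpace.basisFun_apply]
    rfl
  -- For m = 0 both seminorms vanish, but injectivity of sampling then makes V trivial,
  -- contradicting `hg`.
  · have hm : 0 < (m : ℝ) := by
      rcases Nat.eq_zero_or_pos m with rfl | hm
      · exact (hg ((sub_eq_zero.1 (hx _ (Subsingleton.elim _ _))))).elim
      · exact_mod_cast hm
    rw [sampleNorm_eq, sampleNorm_eq, map_sub, map_sub]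
    exact mul_lt_mul_of_pos_left (hQmin _ g hg) (Real.sqrt_pos.2 (by positivity))

theorem theorem1 :
    ∃ C : ℝ, 0 < C ∧
      ∀ (D : Type*) (n : ℕ) (V : Submodule ℂ (BoundedFun D)),
        FiniteDimensional ℂ V → Module.finrank ℂ V = n →
        ∃ (x : Fin (2 * n) → D) (φ : Fin (2 * n) → V) (P : BoundedFun D →L[ℂ] V),
          (∀ f : BoundedFun D, P f = ∑ i, f (x i) • φ i) ∧
          (∀ g : V, P (g : BoundedFun D) = g) ∧
          ‖P‖ ≤ C * Real.sqrt n ∧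
          (∀ g : V, ‖g‖ ≤ C * Real.sqrt n * sampleNorm x (g : BoundedFun D)) ∧
          IsLeastSquares x V P := by
  refine ⟨3, by norm_num, fun D n V _ hn => ?_⟩
  obtain ⟨x, hx⟩ := exists_sampling_points V hn
  have hinj : ∀ g : V, sampling x (g : BoundedFun D) = 0 → g = 0 := by
    refine fun g hg => norm_le_zero_iff.1 ((hx g).trans_eq ?_)
    rw [hg, norm_zero, mul_zero]
  obtain ⟨P, ⟨φ, hφ⟩, hproj, hle, hls⟩ := exists_isLeastSquares V x hinj
  have hdisc : ∀ g : V, ‖g‖ ≤ 3 * Real.sqrt n * sampleNorm x (g : BoundedFun D) := by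
    intro g
    refine (hx g).trans ?_
    rcases Nat.eq_zero_or_pos n with rfl | hpos
    · have : Subsingleton (EuclideanSpace ℂ (Fin (2 * 0))) :=
        inferInstanceAs (Subsingleton (EuclideanSpace ℂ (Fin 0)))
      rw [Subsingleton.elim (sampling x (g : BoundedFun D)) 0]
      simp
    rw [sampleNorm_eq, ← mul_assoc, mul_assoc 3, ← Real.sqrt_mul (by positivity)]
    have hn' : (n : ℝ) ≠ 0 := by positivity
    have : (n : ℝ) * (1 / ((2 * n : ℕ) : ℝ)) = 1 / 2 := by
      push_cast
      field_simp
    rw [this]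
    -- This is where C = 3 comes from: it must be at least 2√2.
    have : (2 / 3 : ℝ) ≤ Real.sqrt (1 / 2) := Real.le_sqrt_of_sq_le (by norm_num)
    exact mul_le_mul_of_nonneg_right (by linarith) (norm_nonneg _)
  have hbound : ∀ f, ‖P f‖ ≤ 3 * Real.sqrt n * ‖f‖ := by
    intro f
    refine (hdisc (P f)).trans (mul_le_mul_of_nonneg_left ?_ (by positivity))
    refine le_trans ?_ (sampleNorm_le_norm x f)
    rw [sampleNorm_eq, sampleNorm_eq]
    exact mul_le_mul_of_nonneg_left (hle f) (Real.sqrt_nonneg _)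
  exact ⟨x, φ, P.mkContinuous _ hbound, hφ, hproj, P.mkContinuous_norm_le (by positivity) hbound,
    hdisc, hls⟩
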